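/- For $a>0$ let $\mathfrak D(a)=\{t\in\mathbb C:\operatorname{dist}(t,(0,+\infty))<a\}$. For $a>0$ and $R\ge 0$ let $H(a,R)$ be the space of all functions $F$ that are analytic in $\mathfrak D(a)$ and of exponential growth of type $R$ there: for all $0<A<a$ and $r>R$ there is a constant $M$ with $|F(t)|\le M e^{r|t|}$ for all $t\in\mathfrak D(A)$. Let $H=\bigcup_{a>0,\,R\ge 0}H(a,R)$. For $F\in H$ and $\alpha\in\mathbb C$ with $\operatorname{Re}\alpha>-1$ let $$\mathcal L\{F\}(\zeta)=\zeta\int_0^{+\infty}e^{-\zeta t}F(t)\,dt,\qquad \mathcal L_\alpha\{F\}(\zeta)=\zeta^{\alpha}\mathcal L\{t^\alpha F(t)\}(\zeta)$$ (principal branches; $\operatorname{Re}\zeta$ large), and let the fractional derivative of order $\alpha$ be $\mathcal D_\alpha=\mathcal L^{-1}\mathcal L_\alpha$, i.e. $\mathcal D_\alpha\{F\}$ is the function $G\in H$ with $\mathcal L\{G\}=\mathcal L_\alpha\{F\}$ on some right half-plane. **Theorem 3.** Let $a>0$, $R\ge 0$, $F\in H(a,R)$ and $\operatorname{Re}\alpha>-1$.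 Then $\mathcal D_\alpha\{F\}\in H$ exists, and for every $\zeta$ with $\operatorname{Re}\zeta>R$ the Laplace–Mellin transform $$P(\zeta,\alpha)=\zeta^{1+\alpha}\int_0^{+\infty}e^{-\zeta t}t^\alpha F(t)\,dt$$ (an absolutely convergent integral) satisfies $$P(\zeta,\alpha)=\zeta\int_0^{+\infty}e^{-\zeta t}\,\mathcal D_\alpha\{F\}(t)\,dt,$$ where the integral on the right converges absolutely. -/

import Mathlib

open MeasureTheory Set

namespace LaplaceBorel

noncomputable section

/-- The region `{t ∈ ℂ : dist (t, (0, +∞)) < a}`. -/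
def region (a : ℝ) : Set ℂ :=
  {t : ℂ | Metric.infDist t ((fun x : ℝ => (x : ℂ)) '' Ioi (0 : ℝ)) < a}

/-- The space `H(a, R)`: functions analytic in `region a` and of exponential growth of type (at
most) `R` there, that is, bounded by a multiple of `exp (r |t|)` for every `r > R`. As the functions
may be singular on the boundary of `region a` (for instance `1 / (1 + t)` lies in `H(1, 0)`), the
growth is measured on the smaller regions `region A`, `0 < A < a`. -/
def spaceH (a R : ℝ) : Set (ℂ → ℂ) :=
  {F | AnalyticOnNhd ℂ F (region a) ∧
    ∀ A : ℝ, 0 < A → A < a → ∀ r : ℝ, R < r →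
      ∃ M : ℝ, ∀ t ∈ region A, ‖F t‖ ≤ M * Real.exp (r * ‖t‖)}

/-- The normalized Laplace transform `ℒ{F}(ζ) = ζ ∫₀^∞ e^{-ζt} F(t) dt`. -/
def laplaceOp (F : ℂ → ℂ) (ζ : ℂ) : ℂ :=
  ζ * ∫ t in Ioi (0 : ℝ), Complex.exp (-ζ * t) * F t

/-- The operator `ℒ_α{F}(ζ) = ζ^α ℒ{t^α F(t)}(ζ)` (principal branches). -/
def laplaceAlpha (α : ℂ) (F : ℂ → ℂ) (ζ : ℂ) : ℂ :=
  ζ ^ α * laplaceOp (fun t => t ^ α * F t) ζ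

/-- `G` is an inverse Laplace image of `P`: `G` belongs to the space `H`, the union of the `H(b, ρ)`
over `b > 0` and `ρ ≥ 0`, and `ℒ{G} = P` on a right half-plane. -/
def IsLaplaceInverse (P G : ℂ → ℂ) : Prop :=
  ∃ b ρ : ℝ, 0 < b ∧ 0 ≤ ρ ∧ G ∈ spaceH b ρ ∧ ∀ ζ : ℂ, ρ < ζ.re → laplaceOp G ζ = P ζ

open Classical in
/-- The inverse operator `ℒ⁻¹`, with the value `0` outside of the image of `H` under `ℒ`. -/
def laplaceInv (P : ℂ → ℂ) : ℂ → ℂ :=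
  if h : ∃ G : ℂ → ℂ, IsLaplaceInverse P G then h.choose else 0

/-- The fractional derivative `𝓓_α = ℒ⁻¹ ℒ_α`. -/
def fracDeriv (α : ℂ) (F : ℂ → ℂ) : ℂ → ℂ :=
  laplaceInv (laplaceAlpha α F)

end

end LaplaceBorel

/-!
Let `F ∈ H(a, R)` and let `m` be a natural number with `m > Re α`. If `F = ∑ fₙ tⁿ` near `0`, the
fractional derivative has to be `G = ∑ Γ(n + 1 + α) / n! · fₙ tⁿ`. Writing
`Γ(n + 1 + α) / n! = Β(n + 1 + α, m - α) / Γ(m - α) · (n + 1) ⋯ (n + m)` suggests the formula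
`G = (d/dt)ᵐ (tᵐ K)`, `K(t) = Γ(m - α)⁻¹ ∫₀¹ x^α (1 - x)^(m - α - 1) F(xt) dx`, which makes sense
without power series. The regions are star-shaped about `0`, so `K` again lies in `H(a, R)`
(`spaceH.betaAverage_mem`), and Cauchy's estimates show that `H(a, R)` is stable under
differentiation (`spaceH.deriv_mem`). Hence `G ∈ H(a, R)`, with no loss in `a` or `R`.

For `t > 0` the function `tᵐ K(t)` is the convolution of `t^α F(t)` with
`t^(m - α - 1) / Γ(m - α)`, so its Laplace integral is `ζ^(α - m) ∫ e^{-ζt} t^α F(t) dt`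
(`integral_exp_mul_cpow_mul_betaAverage`); each of the `m` derivatives contributes a factor `ζ`
(`exists_integral_eq_pow_mul_integral_pow`). This gives the identity for `G` in the whole half-plane
`Re ζ > R`.

The operator `ℒ⁻¹` only provides some function of `H` with the right transform in some half-plane.
By uniqueness of the Laplace transform, which is reduced to Fourier inversion
(`eqOn_zero_of_laplace_eq_zero`), it coincides with `G` on the positive axis, and this is all
that the integrals see.
-/

namespace LaplaceBorel

/-! ### The regions around the positive axis -/

lemma nonempty_ofReal_image_Ioi : ((fun x : ℝ => (x : ℂ)) '' Ioi (0 : ℝ)).Nonempty :=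
  nonempty_Ioi.image _

lemma isOpen_region (a : ℝ) : IsOpen (region a) :=
  isOpen_lt (Metric.continuous_infDist_pt _) continuous_const

lemma region_mono {a b : ℝ} (h : a ≤ b) : region a ⊆ region b :=
  fun _ ht => lt_of_lt_of_le ht h

lemma ball_subset_region {A δ : ℝ} {t : ℂ} (ht : t ∈ region A) :
    Metric.ball t δ ⊆ region (A + δ) := by
  intro z hz
  have h := Metric.infDist_le_infDist_add_dist (x := z) (y := t)
    (s := (fun x : ℝ => (x : ℂ)) '' Ioi (0 : ℝ))
  rw [Metric.mem_ball] at hz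
  exact h.trans_lt (add_lt_add ht hz)

lemma ofReal_mem_region {a t : ℝ} (ha : 0 < a) (ht : 0 ≤ t) : (t : ℂ) ∈ region a := by
  have hpos : 0 < t + a / 2 := by linarith
  refine (Metric.infDist_lt_iff nonempty_ofReal_image_Ioi).2 ⟨_, ⟨t + a / 2, hpos, rfl⟩, ?_⟩
  rw [Complex.dist_eq, ← Complex.ofReal_sub, Complex.norm_real, Real.norm_eq_abs, abs_lt]
  constructor <;> linarith

lemma ofReal_mul_mem_region {a s : ℝ} {t : ℂ} (hs : 0 < s) (hs1 : s ≤ 1) (ht : t ∈ region a) :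
    (s : ℂ) * t ∈ region a := by
  obtain ⟨_, ⟨x, hx, rfl⟩, hxt⟩ := (Metric.infDist_lt_iff nonempty_ofReal_image_Ioi).1 ht
  refine (Metric.infDist_lt_iff nonempty_ofReal_image_Ioi).2 ⟨_, ⟨s * x, mul_pos hs hx, rfl⟩, ?_⟩
  rw [Complex.dist_eq] at hxt ⊢
  have : (s : ℂ) * t - ((s * x : ℝ) : ℂ) = s * (t - x) := by push_cast; ring
  rw [this, norm_mul, Complex.norm_real, Real.norm_of_nonneg hs.le]
  exact (mul_le_of_le_one_left (norm_nonneg _) hs1).trans_lt hxt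

lemma exists_mem_region_lt {a : ℝ} {t : ℂ} (ha : 0 < a) (ht : t ∈ region a) :
    ∃ A, 0 < A ∧ A < a ∧ t ∈ region A := by
  obtain ⟨A, hA, hAa⟩ := exists_between
    (max_lt ha ht : max 0 (Metric.infDist t ((fun x : ℝ => (x : ℂ)) '' Ioi (0 : ℝ))) < a)
  exact ⟨A, (le_max_left _ _).trans_lt hA, hAa, (le_max_right _ _).trans_lt hA⟩

/-! ### Stability of the spaces `H(a, R)` -/

variable {a R : ℝ} {F G : ℂ → ℂ}

lemma mem_spaceH_iff_differentiableOn :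
    F ∈ spaceH a R ↔ DifferentiableOn ℂ F (region a) ∧
      ∀ A : ℝ, 0 < A → A < a → ∀ r : ℝ, R < r →
        ∃ M : ℝ, ∀ t ∈ region A, ‖F t‖ ≤ M * Real.exp (r * ‖t‖) := by
  rw [← Complex.analyticOnNhd_iff_differentiableOn (isOpen_region a)]
  rfl

lemma spaceH.exists_nonneg_bound (hF : F ∈ spaceH a R) {A r : ℝ} (hA : 0 < A) (hAa : A < a)
    (hr : R < r) : ∃ M : ℝ, 0 ≤ M ∧ ∀ t ∈ region A, ‖F t‖ ≤ M * Real.exp (r * ‖t‖) := by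
  obtain ⟨M, hM⟩ := hF.2 A hA hAa r hr
  refine ⟨|M|, abs_nonneg M, fun t ht => (hM t ht).trans ?_⟩
  gcongr
  exact le_abs_self M

lemma spaceH.add_mem (hF : F ∈ spaceH a R) (hG : G ∈ spaceH a R) :
    (fun t => F t + G t) ∈ spaceH a R := by
  refine ⟨hF.1.add hG.1, fun A hA hAa r hr => ?_⟩
  obtain ⟨M, hM⟩ := hF.2 A hA hAa r hr
  obtain ⟨N, hN⟩ := hG.2 A hA hAa r hr
  refine ⟨M + N, fun t ht => (norm_add_le _ _).trans ?_⟩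
  rw [add_mul]
  exact add_le_add (hM t ht) (hN t ht)

lemma spaceH.const_mul_mem (c : ℂ) (hF : F ∈ spaceH a R) : (fun t => c * F t) ∈ spaceH a R := by
  refine ⟨analyticOnNhd_const.mul hF.1, fun A hA hAa r hr => ?_⟩
  obtain ⟨M, hM⟩ := hF.2 A hA hAa r hr
  refine ⟨‖c‖ * M, fun t ht => ?_⟩
  rw [norm_mul, mul_assoc]
  gcongr
  exact hM t ht

lemma spaceH.id_mul_mem (hF : F ∈ spaceH a R) : (fun t => t * F t) ∈ spaceH a R := by
  refine ⟨analyticOnNhd_id.mul hF.1, fun A hA hAa r hr => ?_⟩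
  -- The factor `|t|` is absorbed by passing from a type `q` with `R < q < r` to `r`.
  obtain ⟨q, hRq, hqr⟩ := exists_between hr
  obtain ⟨M, hM0, hM⟩ := spaceH.exists_nonneg_bound hF hA hAa hRq
  have hd : 0 < r - q := sub_pos.2 hqr
  refine ⟨(r - q)⁻¹ * M, fun t ht => ?_⟩
  have h1 : ‖t‖ ≤ (r - q)⁻¹ * Real.exp ((r - q) * ‖t‖) := by
    rw [le_inv_mul_iff₀ hd]
    linarith [Real.add_one_le_exp ((r - q) * ‖t‖)]
  calc ‖t * F t‖ = ‖t‖ * ‖F t‖ := norm_mul _ _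
    _ ≤ ((r - q)⁻¹ * Real.exp ((r - q) * ‖t‖)) * (M * Real.exp (q * ‖t‖)) := by
        gcongr
        exact hM t ht
    _ = (r - q)⁻¹ * M * (Real.exp ((r - q) * ‖t‖) * Real.exp (q * ‖t‖)) := by ring
    _ = (r - q)⁻¹ * M * Real.exp (r * ‖t‖) := by
        rw [← Real.exp_add]
        ring_nf

/-- Differentiation preserves `H(a, R)`: by Cauchy's estimate on discs of a fixed radius, the
growth of `F` on `region A'` controls that of `F'` on `region A` for `A < A' < a`. -/
lemma spaceH.deriv_mem (hR : 0 ≤ R) (hF : F ∈ spaceH a R) : deriv F ∈ spaceH a R := by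
  refine ⟨hF.1.deriv, fun A hA hAa r hr => ?_⟩
  obtain ⟨A', hAA', hA'a⟩ := exists_between hAa
  obtain ⟨δ, hδ, hδA⟩ := exists_between (sub_pos.2 hAA')
  obtain ⟨M, hM0, hM⟩ := spaceH.exists_nonneg_bound hF (hA.trans hAA') hA'a hr
  have hr0 : 0 ≤ r := hR.trans hr.le
  refine ⟨M * Real.exp (r * δ) / δ, fun t ht => ?_⟩
  have hsub : Metric.closedBall t δ ⊆ region A' := by
    refine (Metric.closedBall_subset_ball (show δ < A' - A from hδA)).trans ?_
    simpa using ball_subset_region (δ := A' - A) ht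
  have hd : DifferentiableOn ℂ F (Metric.closedBall t δ) :=
    hF.1.differentiableOn.mono (hsub.trans (region_mono hA'a.le))
  have h := Complex.norm_deriv_le_of_forall_mem_sphere_norm_le hδ
    (hd.diffContOnCl_ball subset_rfl) (C := M * Real.exp (r * δ) * Real.exp (r * ‖t‖)) ?_
  · rwa [mul_div_right_comm] at h
  intro z hz
  refine (hM z (hsub (Metric.sphere_subset_closedBall hz))).trans ?_
  rw [mul_assoc, ← Real.exp_add, ← mul_add]
  gcongr
  rw [mem_sphere_iff_norm] at hz
  calc ‖z‖ = ‖(z - t) + t‖ := by rw [sub_add_cancel]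
    _ ≤ δ + ‖t‖ := hz ▸ norm_add_le _ _

lemma spaceH.continuousOn_ofReal (ha : 0 < a) (hF : F ∈ spaceH a R) :
    ContinuousOn (fun t : ℝ => F t) (Ici 0) :=
  hF.1.continuousOn.comp Complex.continuous_ofReal.continuousOn
    fun _ ht => ofReal_mem_region ha ht

lemma spaceH.exists_bound_ofReal (ha : 0 < a) (hF : F ∈ spaceH a R) {r : ℝ} (hr : R < r) :
    ∃ M : ℝ, ∀ t : ℝ, 0 ≤ t → ‖F t‖ ≤ M * Real.exp (r * t) := by
  obtain ⟨M, hM⟩ := hF.2 (a / 2) (half_pos ha) (half_lt_self ha) r hr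
  refine ⟨M, fun t ht => ?_⟩
  simpa [abs_of_nonneg ht] using hM t (ofReal_mem_region (half_pos ha) ht)

/-! ### Laplace integrals -/

lemma exp_neg_mul_mul_cpow_integrableOn {g : ℝ → ℂ} (hg : ContinuousOn g (Ioi 0)) {M r : ℝ}
    (hM : ∀ t : ℝ, 0 < t → ‖g t‖ ≤ M * Real.exp (r * t)) {ζ β : ℂ} (hζ : r < ζ.re)
    (hβ : -1 < β.re) :
    IntegrableOn (fun t : ℝ => Complex.exp (-ζ * t) * (t : ℂ) ^ β * g t) (Ioi 0) := by
  have hint : IntegrableOn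
      (fun t : ℝ => M * (t ^ β.re * Real.exp (-(ζ.re - r) * t ^ (1 : ℝ)))) (Ioi 0) :=
    (integrableOn_rpow_mul_exp_neg_mul_rpow hβ one_pos (sub_pos.2 hζ)).const_mul M
  refine hint.mono' ?_ ?_
  · refine ContinuousOn.aestronglyMeasurable ?_ measurableSet_Ioi
    refine (ContinuousOn.mul (by fun_prop) fun t ht => ?_).mul hg
    exact (Complex.continuousAt_ofReal_cpow_const t β (Or.inr (ne_of_gt ht))).continuousWithinAt
  · refine (ae_restrict_iff' measurableSet_Ioi).2 (ae_of_all _ fun t ht => ?_)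
    have hexp : ‖Complex.exp (-ζ * t)‖ = Real.exp (-ζ.re * t) := by
      simp [Complex.norm_exp]
    rw [norm_mul, norm_mul, hexp, Complex.norm_cpow_eq_rpow_re_of_pos ht, Real.rpow_one]
    have he : Real.exp (-(ζ.re - r) * t) = Real.exp (-ζ.re * t) * Real.exp (r * t) := by
      rw [← Real.exp_add]
      ring_nf
    calc Real.exp (-ζ.re * t) * t ^ β.re * ‖g t‖
        ≤ Real.exp (-ζ.re * t) * t ^ β.re * (M * Real.exp (r * t)) := by
          have := Real.rpow_nonneg (le_of_lt ht) β.re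
          gcongr
          exact hM t ht
      _ = _ := by rw [he]; ring

/-- Absolute convergence of the Laplace–Mellin integral in the half-plane `Re ζ > R`. -/
lemma spaceH.integrableOn_cpow (ha : 0 < a) (hF : F ∈ spaceH a R) {ζ β : ℂ} (hζ : R < ζ.re)
    (hβ : -1 < β.re) :
    IntegrableOn (fun t : ℝ => Complex.exp (-ζ * t) * (t : ℂ) ^ β * F t) (Ioi 0) := by
  obtain ⟨r, hRr, hrζ⟩ := exists_between hζ
  obtain ⟨M, hM⟩ := spaceH.exists_bound_ofReal ha hF hRr
  exact exp_neg_mul_mul_cpow_integrableOn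
    ((spaceH.continuousOn_ofReal ha hF).mono Ioi_subset_Ici_self) (fun t ht => hM t ht.le) hrζ hβ

lemma spaceH.integrableOn_pow (ha : 0 < a) (hF : F ∈ spaceH a R) {ζ : ℂ} (hζ : R < ζ.re)
    (n : ℕ) : IntegrableOn (fun t : ℝ => Complex.exp (-ζ * t) * ((t : ℂ) ^ n * F t)) (Ioi 0) := by
  have hn : -1 < (n : ℂ).re := by simpa using neg_one_lt_zero.trans_le (Nat.cast_nonneg (α := ℝ) n)
  simpa [mul_assoc] using spaceH.integrableOn_cpow ha hF hζ hn

lemma spaceH.integrableOn (ha : 0 < a) (hF : F ∈ spaceH a R) {ζ : ℂ} (hζ : R < ζ.re) :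
    IntegrableOn (fun t : ℝ => Complex.exp (-ζ * t) * F t) (Ioi 0) := by
  simpa using spaceH.integrableOn_pow ha hF hζ 0

/-- Integration by parts for `tⁿ⁺¹ F`, whose derivative is `tⁿ G` with `G = (n + 1) F + t F'`. The
boundary term at `0` vanishes because of the factor `tⁿ⁺¹`. Keeping the power of `t` explicit
is what lets the lemma be iterated. -/
lemma exists_integral_eq_mul_integral_pow_succ (ha : 0 < a) (hR : 0 ≤ R) (n : ℕ)
    (hF : F ∈ spaceH a R) :
    ∃ G ∈ spaceH a R, ∀ ζ : ℂ, R < ζ.re →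
      ∫ t in Ioi (0 : ℝ), Complex.exp (-ζ * t) * ((t : ℂ) ^ n * G t) =
        ζ * ∫ t in Ioi (0 : ℝ), Complex.exp (-ζ * t) * ((t : ℂ) ^ (n + 1) * F t) := by
  have hG : (fun t => ((n : ℂ) + 1) * F t + t * deriv F t) ∈ spaceH a R :=
    spaceH.add_mem (spaceH.const_mul_mem _ hF) (spaceH.id_mul_mem (spaceH.deriv_mem hR hF))
  refine ⟨_, hG, fun ζ hζ => ?_⟩
  have hintF := spaceH.integrableOn_pow ha hF hζ (n + 1)
  have hintG := spaceH.integrableOn_pow ha hG hζ n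
  have hderiv : ∀ t ∈ Ici (0 : ℝ), HasDerivAt
      (fun t : ℝ => Complex.exp (-ζ * t) * ((t : ℂ) ^ (n + 1) * F t))
      (Complex.exp (-ζ * t) * ((t : ℂ) ^ n * (((n : ℂ) + 1) * F t + t * deriv F t)) -
        ζ * (Complex.exp (-ζ * t) * ((t : ℂ) ^ (n + 1) * F t))) t := by
    intro t ht
    have hFt : HasDerivAt F (deriv F t) (t : ℂ) :=
      (hF.1 t (ofReal_mem_region ha ht)).differentiableAt.hasDerivAt
    have h1 : HasDerivAt (fun z : ℂ => Complex.exp (-ζ * z)) (Complex.exp (-ζ * t) * -ζ) (t : ℂ) := by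
      simpa using ((hasDerivAt_id (t : ℂ)).const_mul (-ζ)).cexp
    have h2 := (h1.mul ((hasDerivAt_pow (n + 1) (t : ℂ)).mul hFt)).comp_ofReal
    convert! h2 using 1
    push_cast
    simp only [Pi.mul_apply]
    ring
  have hint' := hintG.sub (hintF.const_mul ζ)
  have hlim := tendsto_zero_of_hasDerivAt_of_integrableOn_Ioi
    (fun t ht => hderiv t (Ioi_subset_Ici_self ht)) hint' hintF
  have h := integral_Ioi_of_hasDerivAt_of_tendsto' hderiv hint' hlim
  rw [integral_sub hintG (hintF.const_mul ζ), integral_const_mul] at h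
  simpa [sub_eq_zero] using h

/-- The function `G` is the `n`-th derivative of `tⁿ F`. -/
lemma exists_integral_eq_pow_mul_integral_pow (ha : 0 < a) (hR : 0 ≤ R) (n : ℕ)
    (hF : F ∈ spaceH a R) :
    ∃ G ∈ spaceH a R, ∀ ζ : ℂ, R < ζ.re →
      ∫ t in Ioi (0 : ℝ), Complex.exp (-ζ * t) * G t =
        ζ ^ n * ∫ t in Ioi (0 : ℝ), Complex.exp (-ζ * t) * ((t : ℂ) ^ n * F t) := by
  induction n generalizing F with
  | zero => exact ⟨F, hF, fun ζ _ => by simp⟩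
  | succ n ih =>
    obtain ⟨K, hK, hKF⟩ := exists_integral_eq_mul_integral_pow_succ ha hR n hF
    obtain ⟨G, hG, hGK⟩ := ih hK
    refine ⟨G, hG, fun ζ hζ => ?_⟩
    rw [hGK ζ hζ, hKF ζ hζ, pow_succ, mul_assoc]

/-! ### The Laplace transform of a power -/

/-- The Laplace transform `∫₀^∞ e^{-ζt} t^{v-1} dt` of a power is holomorphic for `Re ζ > 0`. -/
lemma differentiableOn_integral_exp_mul_cpow {v : ℂ} (hv : 0 < v.re) :
    DifferentiableOn ℂ (fun ζ : ℂ => ∫ t in Ioi (0 : ℝ), Complex.exp (-ζ * t) * (t : ℂ) ^ (v - 1))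
      {ζ | 0 < ζ.re} := by
  intro ζ hζ
  have hζ : 0 < ζ.re := hζ
  have hv1 : -1 < (v - 1).re := by simpa using hv
  have hvv : -1 < (v - 1 + 1).re := by simp; linarith
  have hmeas : ∀ (w z : ℂ), 0 < w.re → -1 < z.re →
      IntegrableOn (fun t : ℝ => Complex.exp (-w * t) * (t : ℂ) ^ z) (Ioi 0) := by
    intro w z hw hz
    simpa using exp_neg_mul_mul_cpow_integrableOn (g := fun _ => 1) continuousOn_const
      (M := 1) (r := 0) (by simp) hw hz
  have hhalf : 0 < ((ζ.re / 2 : ℝ) : ℂ).re := by simpa using hζ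
  have hs : {w : ℂ | ζ.re / 2 < w.re} ∈ nhds ζ :=
    (isOpen_lt continuous_const Complex.continuous_re).mem_nhds (half_lt_self hζ)
  refine (hasDerivAt_integral_of_dominated_loc_of_deriv_le (s := {w : ℂ | ζ.re / 2 < w.re})
    (μ := volume.restrict (Ioi (0 : ℝ)))
    (F := fun w (t : ℝ) => Complex.exp (-w * t) * (t : ℂ) ^ (v - 1))
    (F' := fun w (t : ℝ) => Complex.exp (-w * t) * -t * (t : ℂ) ^ (v - 1))
    (bound := fun t : ℝ => ‖Complex.exp (-((ζ.re / 2 : ℝ) : ℂ) * t) * (t : ℂ) ^ (v - 1 + 1)‖)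
    hs ?_ (hmeas ζ _ hζ hv1) ?_ ?_ (hmeas _ _ hhalf hvv).norm
    ?_).2.differentiableAt.differentiableWithinAt
  · filter_upwards [hs] with w hw
    exact (hmeas w _ ((half_pos hζ).trans hw) hv1).aestronglyMeasurable
  · refine AEStronglyMeasurable.congr (hmeas ζ _ hζ hvv).neg.aestronglyMeasurable ?_
    refine (ae_restrict_iff' measurableSet_Ioi).2 (ae_of_all _ fun t ht => ?_)
    have ht0 : (t : ℂ) ≠ 0 := Complex.ofReal_ne_zero.2 (ne_of_gt ht)
    simp only [Pi.neg_apply]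
    rw [Complex.cpow_add _ _ ht0, Complex.cpow_one]
    ring
  · refine (ae_restrict_iff' measurableSet_Ioi).2 (ae_of_all _ fun t ht w hw => ?_)
    have ht : 0 < t := ht
    have hw : ζ.re / 2 < w.re := hw
    have ht0 : (t : ℂ) ≠ 0 := Complex.ofReal_ne_zero.2 ht.ne'
    rw [Complex.cpow_add _ _ ht0, Complex.cpow_one, mul_assoc, norm_mul, norm_mul, norm_mul,
      norm_neg, norm_mul, mul_comm ‖(t : ℂ)‖]
    gcongr
    rw [Complex.norm_exp, Complex.norm_exp]
    rw [Complex.re_mul_ofReal, Complex.re_mul_ofReal, Complex.neg_re, Complex.neg_re,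
      Complex.ofReal_re]
    gcongr
  · refine ae_of_all _ fun t w _ => ?_
    have h1 : HasDerivAt (fun z : ℂ => Complex.exp (-z * t)) (Complex.exp (-w * t) * -t) w := by
      simpa using ((hasDerivAt_id w).neg.mul_const (t : ℂ)).cexp
    exact h1.mul_const _

/-- The formula holds for real `ζ` by the definition of the Gamma function and extends to the
half-plane by analytic continuation. -/
lemma integral_exp_neg_mul_mul_cpow {v ζ : ℂ} (hv : 0 < v.re) (hζ : 0 < ζ.re) :
    ∫ t in Ioi (0 : ℝ), Complex.exp (-ζ * t) * (t : ℂ) ^ (v - 1) = Complex.Gamma v * ζ ^ (-v) := by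
  have hopen : IsOpen {ζ : ℂ | 0 < ζ.re} := isOpen_lt continuous_const Complex.continuous_re
  have hpre : IsPreconnected {ζ : ℂ | 0 < ζ.re} := (convex_halfSpace_re_gt 0).isPreconnected
  have hd : DifferentiableOn ℂ (fun ζ : ℂ => Complex.Gamma v * ζ ^ (-v)) {ζ | 0 < ζ.re} :=
    fun w hw => ((differentiableAt_id.cpow_const (Or.inl hw)).const_mul _).differentiableWithinAt
  refine ((differentiableOn_integral_exp_mul_cpow hv).analyticOnNhd
    hopen).eqOn_of_preconnected_of_frequently_eq (hd.analyticOnNhd hopen) hpre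
    (z₀ := 1) (by simp) ?_ hζ
  -- The identity holds on the positive axis, which accumulates at `1`.
  have hreal : ∀ x : ℝ, 0 < x →
      ∫ t in Ioi (0 : ℝ), Complex.exp (-(x : ℂ) * t) * (t : ℂ) ^ (v - 1) =
        Complex.Gamma v * (x : ℂ) ^ (-v) := by
    intro x hx
    have h := Complex.integral_cpow_mul_exp_neg_mul_Ioi hv hx
    rw [one_div, Complex.inv_cpow _ _ (by
      rw [Complex.arg_ofReal_of_nonneg hx.le]; exact Real.pi_pos.ne), ← Complex.cpow_neg] at h
    rw [mul_comm, ← h]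
    refine integral_congr_ae (ae_of_all _ fun t => ?_)
    simp only [neg_mul]
    rw [mul_comm]
  have htend : Filter.Tendsto (fun x : ℝ => (x : ℂ)) (nhdsWithin 1 (Ioi 1))
      (nhdsWithin 1 {1}ᶜ) := by
    refine tendsto_nhdsWithin_iff.2 ⟨?_, ?_⟩
    · exact (Complex.continuous_ofReal.tendsto' 1 1 (by simp)).mono_left nhdsWithin_le_nhds
    · filter_upwards [self_mem_nhdsWithin] with x hx
      simpa using ne_of_gt hx
  refine htend.frequently (Filter.Eventually.frequently ?_)
  filter_upwards [self_mem_nhdsWithin] with x hx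
  exact hreal x (one_pos.trans hx)

/-! ### Averages against the beta kernel -/

/-- The Erdélyi–Kober type average `∫₀¹ x^(u-1) (1-x)^(v-1) F(xt) dx` of `F` along the segment
from `0` to `t`, not normalized by `Γ(v)`. It multiplies the `n`-th Taylor coefficient of `F` by
`Β(u + n, v)`. -/
noncomputable def betaAverage (u v : ℂ) (F : ℂ → ℂ) (t : ℂ) : ℂ :=
  ∫ x : ℝ in 0..1, (x : ℂ) ^ (u - 1) * (1 - (x : ℂ)) ^ (v - 1) * F (x * t)

lemma spaceH.intervalIntegrable_beta_mul (ha : 0 < a) (hF : F ∈ spaceH a R) {u v : ℂ}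
    (hu : 0 < u.re) (hv : 0 < v.re) {t : ℂ} (ht : t ∈ region a) :
    IntervalIntegrable
      (fun x : ℝ => (x : ℂ) ^ (u - 1) * (1 - (x : ℂ)) ^ (v - 1) * F (x * t)) volume 0 1 := by
  refine (Complex.betaIntegral_convergent hu hv).mul_continuousOn
    (hF.1.continuousOn.comp (by fun_prop) fun x hx => ?_)
  rw [uIcc_of_le zero_le_one] at hx
  rcases hx.1.eq_or_lt with rfl | hx0
  · simpa using ofReal_mem_region ha le_rfl
  · exact ofReal_mul_mem_region hx0 hx.2 ht

lemma spaceH.betaAverage_mem (ha : 0 < a) (hR : 0 ≤ R) (hF : F ∈ spaceH a R) {u v : ℂ}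
    (hu : 0 < u.re) (hv : 0 < v.re) : betaAverage u v F ∈ spaceH a R := by
  have hk := Complex.betaIntegral_convergent hu hv
  rw [mem_spaceH_iff_differentiableOn]
  constructor
  · intro t ht
    obtain ⟨A, hA, hAa, htA⟩ := exists_mem_region_lt ha ht
    have hF' := spaceH.deriv_mem hR hF
    obtain ⟨M, hM0, hM⟩ := spaceH.exists_nonneg_bound hF' hA hAa (lt_add_one R)
    have hs : region A ∩ Metric.ball t 1 ∈ nhds t :=
      Filter.inter_mem ((isOpen_region A).mem_nhds htA) (Metric.ball_mem_nhds t one_pos)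
    have h := intervalIntegral.hasDerivAt_integral_of_dominated_loc_of_deriv_le
      (μ := volume) (a := 0) (b := 1) (s := region A ∩ Metric.ball t 1) (x₀ := t)
      (F := fun t (x : ℝ) => (x : ℂ) ^ (u - 1) * (1 - (x : ℂ)) ^ (v - 1) * F (x * t))
      (F' := fun t (x : ℝ) =>
        (x : ℂ) ^ (u - 1) * (1 - (x : ℂ)) ^ (v - 1) * (deriv F (x * t) * x))
      (bound := fun x : ℝ => ‖(x : ℂ) ^ (u - 1) * (1 - (x : ℂ)) ^ (v - 1)‖ *
        (M * Real.exp ((R + 1) * (‖t‖ + 1))))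
      hs ?_ (spaceH.intervalIntegrable_beta_mul ha hF hu hv ht) ?_ ?_ (hk.norm.mul_const _) ?_
    · exact h.2.differentiableAt.differentiableWithinAt
    · filter_upwards [hs] with w hw
      exact ((spaceH.intervalIntegrable_beta_mul ha hF hu hv
        (region_mono hAa.le hw.1)).def').aestronglyMeasurable
    · have := (spaceH.intervalIntegrable_beta_mul ha hF' hu hv ht).mul_continuousOn
        Complex.continuous_ofReal.continuousOn
      simpa only [mul_assoc] using this.def'.aestronglyMeasurable
    · refine ae_of_all _ fun x hx w hw => ?_
      rw [uIoc_of_le zero_le_one] at hx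
      have hxn : ‖(x : ℂ)‖ ≤ 1 := by
        rw [Complex.norm_real, Real.norm_of_nonneg hx.1.le]
        exact hx.2
      have hwt : ‖w‖ ≤ ‖t‖ + 1 := by
        have := norm_le_insert' w t
        have := mem_ball_iff_norm.1 hw.2
        linarith
      rw [norm_mul]
      gcongr
      calc ‖deriv F (x * w) * x‖ ≤ ‖deriv F (x * w)‖ := by
            rw [norm_mul]
            exact mul_le_of_le_one_right (norm_nonneg _) hxn
        _ ≤ M * Real.exp ((R + 1) * ‖(x : ℂ) * w‖) := hM _ (ofReal_mul_mem_region hx.1 hx.2 hw.1)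
        _ ≤ M * Real.exp ((R + 1) * (‖t‖ + 1)) := by
            gcongr
            rw [norm_mul]
            exact (mul_le_of_le_one_left (norm_nonneg _) hxn).trans hwt
    · refine ae_of_all _ fun x hx w hw => ?_
      rw [uIoc_of_le zero_le_one] at hx
      have hFx : HasDerivAt F (deriv F (x * w)) ((x : ℂ) * w) :=
        (hF.1 _ (ofReal_mul_mem_region hx.1 hx.2
          (region_mono hAa.le hw.1))).differentiableAt.hasDerivAt
      have hlin : HasDerivAt (fun w : ℂ => (x : ℂ) * w) x w := by
        simpa using (hasDerivAt_id w).const_mul (x : ℂ)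
      exact (hFx.comp w hlin).const_mul _
  · intro A hA hAa r hr
    obtain ⟨M, hM0, hM⟩ := spaceH.exists_nonneg_bound hF hA hAa hr
    have hr0 : 0 ≤ r := hR.trans hr.le
    refine ⟨(∫ x : ℝ in 0..1, ‖(x : ℂ) ^ (u - 1) * (1 - (x : ℂ)) ^ (v - 1)‖) * M,
      fun t ht => ?_⟩
    rw [mul_assoc, ← intervalIntegral.integral_mul_const]
    refine intervalIntegral.norm_integral_le_of_norm_le zero_le_one
      (ae_of_all _ fun x hx => ?_) (hk.norm.mul_const _)
    rw [norm_mul]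
    gcongr
    refine (hM _ (ofReal_mul_mem_region hx.1 hx.2 ht)).trans ?_
    gcongr
    rw [norm_mul, Complex.norm_real, Real.norm_of_nonneg hx.1.le]
    exact mul_le_of_le_one_left (norm_nonneg _) hx.2

lemma integral_cpow_mul_sub_cpow_mul (u v : ℂ) (F : ℂ → ℂ) {t : ℝ} (ht : 0 < t) :
    ∫ x : ℝ in 0..t, (x : ℂ) ^ (u - 1) * ((t : ℂ) - x) ^ (v - 1) * F x =
      (t : ℂ) ^ (u + v - 1) * betaAverage u v F t := by
  have ht' : (t : ℂ) ≠ 0 := Complex.ofReal_ne_zero.2 ht.ne'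
  have hpow : (t : ℂ) ^ (u + v - 1) = t * ((t : ℂ) ^ (u - 1) * (t : ℂ) ^ (v - 1)) := by
    rw [show u + v - 1 = 1 + (u - 1) + (v - 1) by ring, Complex.cpow_add _ _ ht',
      Complex.cpow_add _ _ ht', Complex.cpow_one, mul_assoc]
  have hsub := intervalIntegral.smul_integral_comp_mul_right (E := ℂ) (a := 0) (b := 1)
    (fun x : ℝ => (x : ℂ) ^ (u - 1) * ((t : ℂ) - x) ^ (v - 1) * F x) t
  rw [zero_mul, one_mul] at hsub
  rw [← hsub, hpow, mul_assoc, Complex.real_smul, betaAverage,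
    ← intervalIntegral.integral_const_mul ((t : ℂ) ^ (u - 1) * (t : ℂ) ^ (v - 1))]
  congr 1
  refine intervalIntegral.integral_congr fun x hx => ?_
  rw [uIcc_of_le zero_le_one] at hx
  have h1 : ((x * t : ℝ) : ℂ) ^ (u - 1) = (x : ℂ) ^ (u - 1) * (t : ℂ) ^ (u - 1) := by
    rw [Complex.ofReal_mul, Complex.mul_cpow_ofReal_nonneg hx.1 ht.le]
  have h2 : ((t : ℂ) - (x * t : ℝ)) ^ (v - 1) = (1 - (x : ℂ)) ^ (v - 1) * (t : ℂ) ^ (v - 1) := by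
    rw [show (t : ℂ) - (x * t : ℝ) = ((1 - x : ℝ) : ℂ) * t by push_cast; ring,
      Complex.mul_cpow_ofReal_nonneg (sub_nonneg.2 hx.2) ht.le]
    push_cast
    rfl
  simp only [h1, h2]
  rw [Complex.ofReal_mul]
  ring

/-- The beta average is, up to a power of `t`, the convolution of `t^(u-1) F(t)` with `t^(v-1)`, so
the convolution theorem evaluates its Laplace–Mellin transform. -/
lemma integral_exp_mul_cpow_mul_betaAverage (ha : 0 < a) (hR : 0 ≤ R) (hF : F ∈ spaceH a R)
    {u v ζ : ℂ} (hu : 0 < u.re) (hv : 0 < v.re) (hζ : R < ζ.re) :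
    ∫ t in Ioi (0 : ℝ), Complex.exp (-ζ * t) * ((t : ℂ) ^ (u + v - 1) * betaAverage u v F t) =
      Complex.Gamma v * ζ ^ (-v) *
        ∫ t in Ioi (0 : ℝ), Complex.exp (-ζ * t) * (t : ℂ) ^ (u - 1) * F t := by
  have hζ0 : 0 < ζ.re := hR.trans_lt hζ
  have hf : IntegrableOn (fun t : ℝ => Complex.exp (-ζ * t) * (t : ℂ) ^ (u - 1) * F t) (Ioi 0) :=
    spaceH.integrableOn_cpow ha hF hζ (by simpa using hu)
  have hg : IntegrableOn (fun t : ℝ => Complex.exp (-ζ * t) * (t : ℂ) ^ (v - 1)) (Ioi 0) := by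
    simpa using exp_neg_mul_mul_cpow_integrableOn (g := fun _ => 1) (β := v - 1) continuousOn_const
      (M := 1) (r := 0) (by simp) hζ0 (by simpa using hv)
  have hconv := integral_posConvolution hf hg (ContinuousLinearMap.mul ℝ ℂ)
  rw [ContinuousLinearMap.mul_apply', integral_exp_neg_mul_mul_cpow hv hζ0] at hconv
  rw [mul_comm (Complex.Gamma v * ζ ^ (-v)), ← hconv]
  refine setIntegral_congr_fun measurableSet_Ioi fun t ht => ?_
  rw [← integral_cpow_mul_sub_cpow_mul u v F ht, ← intervalIntegral.integral_const_mul]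
  refine intervalIntegral.integral_congr fun x _ => ?_
  have he : Complex.exp (-ζ * t) =
      Complex.exp (-ζ * x) * Complex.exp (-ζ * (t - x : ℝ)) := by
    rw [← Complex.exp_add]
    push_cast
    ring_nf
  simp only [ContinuousLinearMap.mul_apply', he]
  push_cast
  ring

/-! ### Existence of the fractional derivative -/

/-- A representative of the fractional derivative of order `α` that lies in the same space
`H(a, R)` as `F`, with the integral identity on all of the half-plane `Re ζ > R`. -/
lemma exists_mem_spaceH_integral_eq (ha : 0 < a) (hR : 0 ≤ R) {α : ℂ} (hα : -1 < α.re)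
    (hF : F ∈ spaceH a R) :
    ∃ G ∈ spaceH a R, ∀ ζ : ℂ, R < ζ.re →
      ∫ t in Ioi (0 : ℝ), Complex.exp (-ζ * t) * G t =
        ζ ^ α * ∫ t in Ioi (0 : ℝ), Complex.exp (-ζ * t) * (t : ℂ) ^ α * F t := by
  obtain ⟨m, hm⟩ := exists_nat_gt α.re
  have hu : 0 < (α + 1).re := by simpa using by linarith
  have hv : 0 < ((m : ℂ) - α).re := by simpa using hm
  obtain ⟨G, hG, hGK⟩ := exists_integral_eq_pow_mul_integral_pow ha hR m
    (spaceH.const_mul_mem (Complex.Gamma (m - α))⁻¹ (spaceH.betaAverage_mem ha hR hF hu hv))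
  refine ⟨G, hG, fun ζ hζ => ?_⟩
  have hζ0 : ζ ≠ 0 := by
    rintro rfl
    simp only [Complex.zero_re] at hζ
    linarith
  have hΓ : Complex.Gamma (m - α) ≠ 0 := Complex.Gamma_ne_zero_of_re_pos hv
  have hB := integral_exp_mul_cpow_mul_betaAverage ha hR hF hu hv hζ
  rw [show α + 1 + (m - α) - 1 = (m : ℂ) by ring, add_sub_cancel_right] at hB
  simp only [Complex.cpow_natCast] at hB
  have hc : ∀ t : ℝ, Complex.exp (-ζ * t) *
      ((t : ℂ) ^ m * ((Complex.Gamma (m - α))⁻¹ * betaAverage (α + 1) (m - α) F t)) =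
      (Complex.Gamma (m - α))⁻¹ *
        (Complex.exp (-ζ * t) * ((t : ℂ) ^ m * betaAverage (α + 1) (m - α) F t)) := fun t => by
    ring
  have hpow : ζ ^ α = ζ ^ m * ζ ^ (-((m : ℂ) - α)) := by
    rw [← Complex.cpow_natCast, ← Complex.cpow_add _ _ hζ0]
    ring_nf
  rw [hGK ζ hζ]
  simp only [hc]
  rw [integral_const_mul, hB, hpow]
  field_simp

/-! ### Uniqueness of the inverse Laplace transform -/

/-- A function that is continuous on `(0, ∞)` and whose Laplace transform vanishes on a vertical
line of absolute convergence is zero: on that line the Laplace transform of `g` is the Fourier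
transform of `e^{-ct} g(t)`, extended by `0`, and Fourier inversion applies. -/
lemma eqOn_zero_of_laplace_eq_zero {g : ℝ → ℂ} {c : ℝ} (hg : ContinuousOn g (Ioi 0))
    (hint : IntegrableOn (fun t : ℝ => Complex.exp (-(c : ℂ) * t) * g t) (Ioi 0))
    (hzero : ∀ y : ℝ, ∫ t in Ioi (0 : ℝ), Complex.exp (-(c + y * Complex.I) * t) * g t = 0) :
    ∀ t : ℝ, 0 < t → g t = 0 := by
  intro t ht
  set h : ℝ → ℂ := indicator (Ioi 0) fun t : ℝ => Complex.exp (-(c : ℂ) * t) * g t with hh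
  have hI : Integrable h := hint.integrable_indicator measurableSet_Ioi
  have hfour : FourierTransform.fourier h = 0 := by
    ext w
    rw [Real.fourier_real_eq_integral_exp_smul, Pi.zero_apply, ← hzero (2 * Real.pi * w),
      ← integral_indicator measurableSet_Ioi]
    refine integral_congr_ae (ae_of_all _ fun s => ?_)
    by_cases hs : s ∈ Ioi (0 : ℝ)
    · simp only [hh, indicator_of_mem hs, smul_eq_mul]
      rw [← mul_assoc, ← Complex.exp_add]
      push_cast
      ring_nf
    · simp only [hh, indicator_of_notMem hs, smul_zero]
  have hcont : ContinuousAt h t := by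
    have : ContinuousOn (fun t : ℝ => Complex.exp (-(c : ℂ) * t) * g t) (Ioi 0) :=
      ContinuousOn.mul (by fun_prop) hg
    refine (this.continuousAt (Ioi_mem_nhds ht)).congr ?_
    filter_upwards [Ioi_mem_nhds ht] with s hs
    rw [hh, indicator_of_mem hs]
  have hinv := hI.fourierInv_fourier_eq (by rw [hfour]; exact integrable_zero _ _ _) hcont
  have hz : FourierTransformInv.fourierInv (0 : ℝ → ℂ) t = (0 : ℂ) := by
    simp [Real.fourierInv_eq]
  rw [hfour, hz, hh, indicator_of_mem (show t ∈ Ioi (0 : ℝ) from ht)] at hinv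
  exact (mul_eq_zero.1 hinv.symm).resolve_left (Complex.exp_ne_zero _)

lemma eq_of_laplaceOp_eq {b ρ : ℝ} (ha : 0 < a) (hR : 0 ≤ R) (hF : F ∈ spaceH a R) (hb : 0 < b)
    (hG : G ∈ spaceH b ρ) (hFG : ∀ ζ : ℂ, R < ζ.re → ρ < ζ.re → laplaceOp F ζ = laplaceOp G ζ)
    {t : ℝ} (ht : 0 < t) : F t = G t := by
  obtain ⟨c, hc⟩ := exists_gt (max R ρ)
  have hcR : R < c := (le_max_left _ _).trans_lt hc
  have hcρ : ρ < c := (le_max_right _ _).trans_lt hc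
  have hint : ∀ y : ℝ, IntegrableOn
      (fun t : ℝ => Complex.exp (-(c + y * Complex.I) * t) * (F t - G t)) (Ioi 0) ∧
      ∫ t in Ioi (0 : ℝ), Complex.exp (-(c + y * Complex.I) * t) * (F t - G t) = 0 := by
    intro y
    have hre : ((c : ℂ) + y * Complex.I).re = c := by simp
    have hne : (c : ℂ) + y * Complex.I ≠ 0 := fun h => by
      rw [h, Complex.zero_re] at hre
      linarith
    have h1 := spaceH.integrableOn ha hF (hre.symm ▸ hcR)
    have h2 := spaceH.integrableOn hb hG (hre.symm ▸ hcρ)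
    have h3 := mul_left_cancel₀ hne (hFG (c + y * Complex.I) (hre.symm ▸ hcR) (hre.symm ▸ hcρ))
    simp only [mul_sub]
    exact ⟨h1.sub h2, by rw [integral_sub h1 h2, h3, sub_self]⟩
  refine sub_eq_zero.1 (eqOn_zero_of_laplace_eq_zero (g := fun t : ℝ => F t - G t) (c := c)
    ?_ ?_ (fun y => (hint y).2) t ht)
  · exact ((spaceH.continuousOn_ofReal ha hF).sub (spaceH.continuousOn_ofReal hb hG)).mono
      Ioi_subset_Ici_self
  · simpa using (hint 0).1

lemma isLaplaceInverse_laplaceInv {P : ℂ → ℂ} (h : ∃ G, IsLaplaceInverse P G) :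
    IsLaplaceInverse P (laplaceInv P) := by
  rw [laplaceInv, dif_pos h]
  exact h.choose_spec

end LaplaceBorel

theorem theorem3 (a R : ℝ) (ha : 0 < a) (hR : 0 ≤ R) (α : ℂ) (hα : -1 < α.re)
    (F : ℂ → ℂ) (hF : F ∈ LaplaceBorel.spaceH a R) :
    LaplaceBorel.IsLaplaceInverse (LaplaceBorel.laplaceAlpha α F) (LaplaceBorel.fracDeriv α F) ∧
    ∀ ζ : ℂ, R < ζ.re →
      IntegrableOn (fun t : ℝ => Complex.exp (-ζ * t) * (t : ℂ) ^ α * F t) (Ioi (0 : ℝ)) ∧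
      IntegrableOn (fun t : ℝ => Complex.exp (-ζ * t) * LaplaceBorel.fracDeriv α F t)
        (Ioi (0 : ℝ)) ∧
      ζ ^ (1 + α) * (∫ t in Ioi (0 : ℝ), Complex.exp (-ζ * t) * (t : ℂ) ^ α * F t) =
        ζ * ∫ t in Ioi (0 : ℝ), Complex.exp (-ζ * t) * LaplaceBorel.fracDeriv α F t := by
  obtain ⟨G, hG, hGF⟩ := LaplaceBorel.exists_mem_spaceH_integral_eq ha hR hα hF
  have hGop : ∀ ζ : ℂ, R < ζ.re →
      LaplaceBorel.laplaceOp G ζ = LaplaceBorel.laplaceAlpha α F ζ := by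
    intro ζ hζ
    simp only [LaplaceBorel.laplaceAlpha, LaplaceBorel.laplaceOp, hGF ζ hζ, mul_assoc]
    ring
  have hinv := LaplaceBorel.isLaplaceInverse_laplaceInv
    (P := LaplaceBorel.laplaceAlpha α F) ⟨G, a, R, ha, hR, hG, hGop⟩
  refine ⟨hinv, fun ζ hζ => ?_⟩
  -- The chosen inverse image may come with another region and another half-plane, but on the
  -- positive axis it agrees with `G`.
  obtain ⟨b, ρ, hb, -, hD, hDop⟩ := hinv
  have heq : ∀ t ∈ Ioi (0 : ℝ), LaplaceBorel.fracDeriv α F t = G t := fun t ht =>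
    (LaplaceBorel.eq_of_laplaceOp_eq ha hR hG hb hD
      (fun ζ hζR hζρ => (hGop ζ hζR).trans (hDop ζ hζρ).symm) ht).symm
  have hexp : EqOn (fun t : ℝ => Complex.exp (-ζ * t) * LaplaceBorel.fracDeriv α F t)
      (fun t : ℝ => Complex.exp (-ζ * t) * G t) (Ioi 0) := fun t ht => by
    simp only [heq t ht]
  have hζ0 : ζ ≠ 0 := by
    rintro rfl
    simp only [Complex.zero_re] at hζ
    linarith
  refine ⟨LaplaceBorel.spaceH.integrableOn_cpow ha hF hζ hα,
    (LaplaceBorel.spaceH.integrableOn ha hG hζ).congr_fun hexp.symm measurableSet_Ioi, ?_⟩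
  rw [setIntegral_congr_fun measurableSet_Ioi hexp, hGF ζ hζ, Complex.cpow_add _ _ hζ0,
    Complex.cpow_one, mul_assoc]
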